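/- Let $\{X_t\}_{t\in\mathbb{R}}$ be a standard Brownian motion indexed by $\mathbb{R}$ on a probability space $(\Omega,\mathscr{A},\mathbb{P})$; that is, a centered real Gaussian process such that, for all $s,t\in\mathbb{R}$, $\mathbb{E}(X_sX_t)=\min(|s|,|t|)$ if $s$ and $t$ have the same sign, and $\mathbb{E}(X_sX_t)=0$ if $st\le 0$. For $F$ in the complex Hilbert space $L^2(\mathbb{P})=L^2(\Omega,\mathscr{A},\mathbb{P};\mathbb{C})$ and $t\in\mathbb{R}$ put $$\mathcal{T}(F)(t):=\mathbb{E}\left(e^{-iX_t}F\right)=\int_\Omega e^{-iX_t(\omega)}F(\omega)\,d\mathbb{P}(\omega).$$ **Lemma.** Assume $0<s<t$, and let $\mathscr{B}_s$ be the $\sigma$-algebra generated by $\{X_u : u\in\mathbb{R},\ u\le s\}$. If $F\in L^2(\mathbb{P})$ is $\mathscr{B}_s$-measurable (i.e. has a $\mathscr{B}_s$-measurable representative), then $$\mathcal{T}(F)(t)=e^{-\frac{t-s}{2}}\,\mathcal{T}(F)(s).$$ -/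

import Mathlib

open MeasureTheory ProbabilityTheory

/-- Standard Brownian motion indexed by the whole real line, realized on `(Ω, P)`: a centred
Gaussian process of (measurable) real random variables with `𝔼[X s * X t] = min |s| |t|` if `s`
and `t` have the same sign, and `0` if `s * t ≤ 0`. No regularity of the paths is required. -/
structure IsTwoSidedBrownianMotion {Ω : Type*} [MeasurableSpace Ω]
    (X : ℝ → Ω → ℝ) (P : Measure Ω) : Prop where
  measurable : ∀ t, Measurable (X t)
  isGaussianProcess : IsGaussianProcess X P
  integral_eq_zero : ∀ t, ∫ ω, X t ω ∂P = 0
  integral_mul : ∀ s t, ∫ ω, X s ω * X t ω ∂P = if 0 < s * t then min |s| |t| else 0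

/-- The `σ`-algebra on `Ω` generated by `{X u ; u ≤ s}`, where `u` runs over all reals `≤ s`. -/
abbrev pastSigmaAlgebra {Ω : Type*} (X : ℝ → Ω → ℝ) (s : ℝ) : MeasurableSpace Ω :=
  ⨆ (u : ℝ) (_ : u ≤ s), MeasurableSpace.comap (X u) inferInstance

/-- The generalized Fourier transform `𝒯(F)(t) = 𝔼[exp(-i X t) F]` of `F ∈ L²(P)` (complex). -/
noncomputable def gaussianTransform {Ω : Type*} [MeasurableSpace Ω] (X : ℝ → Ω → ℝ)
    (P : Measure Ω) (F : Lp ℂ 2 P) (t : ℝ) : ℂ :=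
  ∫ ω, Complex.exp (-(Complex.I * (X t ω : ℂ))) * F ω ∂P

namespace IsTwoSidedBrownianMotion

variable {Ω : Type*} [MeasurableSpace Ω] {P : Measure Ω} {X : ℝ → Ω → ℝ}

/-! Factor `exp(-i X t) = exp(-i (X t - X s)) * exp(-i X s)`. The increment is jointly Gaussian and
uncorrelated with the past, hence independent of it (`indepFun_sub_of_measurable`), so the
expectation splits. The increment's factor is the characteristic function of N(0, t - s) at -1
(`integral_exp_sub`). -/

lemma memLp_two (hX : IsTwoSidedBrownianMotion X P) (t : ℝ) : MemLp (X t) 2 P :=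
  (hX.isGaussianProcess.hasGaussianLaw_eval t).memLp_two

lemma covariance_eval (hX : IsTwoSidedBrownianMotion X P) (s t : ℝ) :
    cov[X s, X t; P] = if 0 < s * t then min |s| |t| else 0 := by
  have := hX.isGaussianProcess.isProbabilityMeasure
  rw [covariance_eq_sub (hX.memLp_two s) (hX.memLp_two t), hX.integral_eq_zero, zero_mul, sub_zero]
  exact hX.integral_mul s t

/-- The variance of a Brownian increment over `[s, t]` with `0 < s` is `t - s`. -/
lemma variance_sub (hX : IsTwoSidedBrownianMotion X P) {s t : ℝ} (hs : 0 < s) (hst : s ≤ t) :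
    Var[fun ω ↦ X t ω - X s ω; P] = t - s := by
  have := hX.isGaussianProcess.isProbabilityMeasure
  have ht : 0 < t := hs.trans_le hst
  have hY : Measurable fun ω ↦ X t ω - X s ω := (hX.measurable t).sub (hX.measurable s)
  rw [← covariance_self hY.aemeasurable,
    covariance_fun_sub_fun_sub (hX.memLp_two t) (hX.memLp_two s) (hX.memLp_two t)
      (hX.memLp_two s)]
  simp only [hX.covariance_eval]
  simp [hs, ht, abs_of_pos, hst]

/-- After a positive time `s`, the increments are uncorrelated with the past. -/
lemma covariance_sub_eq_zero (hX : IsTwoSidedBrownianMotion X P) {s t u : ℝ} (hs : 0 < s)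
    (hst : s ≤ t) (hu : u ≤ s) : cov[fun ω ↦ X t ω - X s ω, X u; P] = 0 := by
  have := hX.isGaussianProcess.isProbabilityMeasure
  have ht : 0 < t := hs.trans_le hst
  rw [covariance_fun_sub_left (hX.memLp_two t) (hX.memLp_two s) (hX.memLp_two u),
    hX.covariance_eval, hX.covariance_eval]
  rcases lt_or_ge 0 u with h | h
  -- Both minima equal `u`, as `0 < u ≤ s ≤ t`.
  · simp [hs, ht, h, abs_of_pos, hu, hu.trans hst]
  · rw [if_neg (mul_nonpos_of_nonneg_of_nonpos ht.le h).not_gt,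
      if_neg (mul_nonpos_of_nonneg_of_nonpos hs.le h).not_gt, sub_zero]

/-- The characteristic function of a Brownian increment, at `-1`. -/
lemma integral_exp_sub (hX : IsTwoSidedBrownianMotion X P) {s t : ℝ} (hs : 0 < s)
    (hst : s ≤ t) :
    ∫ ω, Complex.exp (-(Complex.I * ((X t ω - X s ω : ℝ) : ℂ))) ∂P
      = Complex.exp (-(((t - s) / 2 : ℝ) : ℂ)) := by
  have hY : Measurable fun ω ↦ X t ω - X s ω := (hX.measurable t).sub (hX.measurable s)
  have hmean : ∫ ω, (X t ω - X s ω) ∂P = 0 := by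
    rw [integral_sub, hX.integral_eq_zero, hX.integral_eq_zero, sub_zero]
    all_goals exact (hX.isGaussianProcess.hasGaussianLaw_eval _).integrable
  have hlaw : P.map (fun ω ↦ X t ω - X s ω) = gaussianReal 0 (t - s).toNNReal := by
    rw [hX.isGaussianProcess.hasGaussianLaw_fun_sub.map_eq_gaussianReal, hmean,
      hX.variance_sub hs hst]
  have h := charFun_gaussianReal (μ := 0) (v := (t - s).toNNReal) (-1)
  rw [← hlaw, charFun_apply_real, integral_map hY.aemeasurable (by fun_prop)] at h
  convert h using 2
  · ext ω
    congr 1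
    push_cast
    ring
  · rw [Real.coe_toNNReal _ (sub_nonneg.2 hst)]
    push_cast
    ring

/-- After a positive time `s`, the increments are independent of the past. -/
lemma indepFun_sub_of_measurable (hX : IsTwoSidedBrownianMotion X P) {s t : ℝ} (hs : 0 < s)
    (hst : s ≤ t) {β : Type*} [MeasurableSpace β] {G : Ω → β}
    (hG : Measurable[pastSigmaAlgebra X s] G) :
    IndepFun (fun ω ↦ X t ω - X s ω) G P := by
  -- The criterion compares two processes, so the increment becomes one indexed by a point.
  have hind : IndepFun (fun ω (_ : Unit) ↦ X t ω - X s ω) (fun ω (u : Set.Iic s) ↦ X u ω) P := by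
    apply IsGaussianProcess.indepFun_of_covariance_eq_zero
    · apply hX.isGaussianProcess.of_isGaussianProcess
      -- Joint Gaussianity: each coordinate is linear in finitely many values of `X`.
      rintro (_ | ⟨u, hu⟩)
      · exact ⟨{s, t},
          { toFun x := x ⟨t, by simp⟩ - x ⟨s, by simp⟩
            map_add' x y := by simp; abel
            map_smul' c x := by simp; ring }, by simp⟩
      · exact ⟨{u},
          { toFun x := x ⟨u, by simp⟩
            map_add' x y := by simp
            map_smul' c x := by simp }, by simp⟩
    · exact fun _ ↦ ((hX.measurable t).sub (hX.measurable s)).aemeasurable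
    · exact fun u ↦ (hX.measurable u).aemeasurable
    · exact fun _ u ↦ hX.covariance_sub_eq_zero hs hst u.2
  have hpast : pastSigmaAlgebra X s ≤
      MeasurableSpace.comap (fun ω (u : Set.Iic s) ↦ X u ω) inferInstance :=
    iSup₂_le fun u hu ↦
      MeasurableSpace.comap_le_comap_pi (g := fun (u : Set.Iic s) ω ↦ X u ω) ⟨u, hu⟩
  rw [IndepFun_iff_Indep]
  exact indep_of_indep_of_le_right
    ((IndepFun_iff_Indep ..).1 (hind.comp (measurable_pi_apply ()) measurable_id))
    (hG.comap_le.trans hpast)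

end IsTwoSidedBrownianMotion

theorem mainTheorem6 {Ω : Type*} [MeasurableSpace Ω] (P : Measure Ω) [IsProbabilityMeasure P]
    (X : ℝ → Ω → ℝ) (hX : IsTwoSidedBrownianMotion X P)
    (s t : ℝ) (hs : 0 < s) (hst : s < t)
    (F : Lp ℂ 2 P) (hF : F ∈ lpMeas ℂ ℂ (pastSigmaAlgebra X s) 2 P) :
    gaussianTransform X P F t
      = Complex.exp (-(((t - s) / 2 : ℝ) : ℂ)) * gaussianTransform X P F s := by
  -- `F` is only a.e. equal to a past-measurable function; independence is applied to the
  -- representative `g`.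
  obtain ⟨g, hg, hFg⟩ := mem_lpMeas_iff_aestronglyMeasurable.1 hF
  have hle : pastSigmaAlgebra X s ≤ ‹MeasurableSpace Ω› :=
    iSup₂_le fun u _ ↦ (hX.measurable u).comap_le
  have hXs : Measurable[pastSigmaAlgebra X s] (X s) :=
    measurable_iff_comap_le.2 (le_iSup₂_of_le s le_rfl le_rfl)
  have hexp : Measurable fun x : ℝ ↦ Complex.exp (-(Complex.I * (x : ℂ))) := by fun_prop
  have hG : Measurable[pastSigmaAlgebra X s]
      fun ω ↦ Complex.exp (-(Complex.I * (X s ω : ℂ))) * g ω :=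
    (hexp.comp hXs).mul hg.measurable
  have hind := (hX.indepFun_sub_of_measurable hs hst.le hG).comp hexp measurable_id
  have hmul := hind.integral_fun_mul_eq_mul_integral
    (hexp.comp ((hX.measurable t).sub (hX.measurable s))).aestronglyMeasurable
    (hG.mono hle le_rfl).aestronglyMeasurable
  simp only [Function.comp_def, id_eq, hX.integral_exp_sub hs hst.le] at hmul
  have hT (r : ℝ) : gaussianTransform X P F r
      = ∫ ω, Complex.exp (-(Complex.I * (X r ω : ℂ))) * g ω ∂P :=
    integral_congr_ae (hFg.mono fun ω h ↦ by simp only [h])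
  rw [hT, hT, ← hmul]
  refine integral_congr_ae (.of_forall fun ω ↦ ?_)
  simp only
  rw [← mul_assoc, ← Complex.exp_add]
  congr 2
  push_cast
  ring
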